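/- Let $n,T\ge 0$ be integers. Let $\mathcal A$ be a quantum query algorithm with access to a permutation $\varphi$ of $\{0,1\}^{2n}$ and to its inverse, through the unitaries $O^{f}:|x\rangle|a\rangle\mapsto|x\rangle|a\oplus f(x)\rangle$ for $f=\varphi$ and $f=\varphi^{-1}$: starting from a fixed state on the two $2n$-qubit query registers and an arbitrary finite-dimensional work register, $\mathcal A$ applies oracle-independent unitary gates, measurements (whose outcomes may determine the later steps) and oracle unitaries, and finally outputs a pair $(x,y)\in\{0,1\}^n\times\{0,1\}^n$. Suppose that $\mathcal A$ makes at most $T$ queries to $\varphi$ and $\varphi^{-1}$ in total. Let $\epsilon$ be the probability, over a uniformly random permutation $\varphi$ of $\{0,1\}^{2n}$ and the measurement outcomes of $\mathcal A$, that the output is a zero pair of $\varphi$, that is, that $\varphi(x\|0^n)=y\|0^n$. Then $$\epsilon\le\frac{50\,(T+1)^2}{2^n}.$$ -/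

import Mathlib

namespace DoubleSidedZeroSearch

noncomputable section

/-- Bit strings of length `m`. -/
abbrev Bits (m : ℕ) : Type := Fin m → Bool

/-- Bitwise addition modulo two. -/
def bitXor {m : ℕ} (a b : Bits m) : Bits m := fun i => xor (a i) (b i)

/-- The `2n`-bit string `x || 0^n`. -/
def padZero {n : ℕ} (x : Bits n) : Bits (n + n) := Fin.append x (fun _ => false)

/-- `(x, y)` is a zero pair of `φ` if `φ (x || 0^n) = y || 0^n`. -/
def IsZeroPair {n : ℕ} (φ : Equiv.Perm (Bits (n + n))) (p : Bits n × Bits n) : Prop :=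
  φ (padZero p.1) = padZero p.2

/-- Computational basis of the query input register (`2n` qubits), the query answer register
(`2n` qubits) and a finite-dimensional work register with basis `W`. -/
abbrev BasisLabel (n : ℕ) (W : Type*) : Type _ := Bits (n + n) × Bits (n + n) × W

/-- The Hilbert space of the whole memory of an algorithm. -/
abbrev Memory (n : ℕ) (W : Type*) : Type _ := EuclideanSpace ℂ (BasisLabel n W)

/-- The classical reversible map `(x, a, w) ↦ (x, a ⊕ f x, w)`. -/
def oracleEquiv {n : ℕ} {W : Type*} (f : Bits (n + n) → Bits (n + n)) :
    Equiv.Perm (BasisLabel n W) where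
  toFun z := (z.1, bitXor z.2.1 (f z.1), z.2.2)
  invFun z := (z.1, bitXor z.2.1 (f z.1), z.2.2)
  left_inv z := by
    refine Prod.ext rfl (Prod.ext ?_ rfl)
    funext i
    simp [bitXor]
  right_inv z := by
    refine Prod.ext rfl (Prod.ext ?_ rfl)
    funext i
    simp [bitXor]

/-- The oracle unitary `O^f`, sending `|x⟩|a⟩|w⟩` to `|x⟩|a ⊕ f x⟩|w⟩`. -/
def oracle {n : ℕ} {W : Type*} [Fintype W] (f : Bits (n + n) → Bits (n + n)) :
    Memory n W ≃ₗᵢ[ℂ] Memory n W :=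
  LinearIsometryEquiv.piLpCongrLeft 2 ℂ ℂ (oracleEquiv f)

/-- Whether a query goes to the permutation or to its inverse. -/
inductive Direction : Type
  | forward
  | inverse

/-- The function that is queried in the given direction. -/
def Direction.queried {n : ℕ} (φ : Equiv.Perm (Bits (n + n))) :
    Direction → Bits (n + n) → Bits (n + n)
  | .forward => φ
  | .inverse => φ.symm

/-- Adaptive quantum query programs: oracle-independent unitary gates, oracle queries, and
(generalised) measurements with finitely many outcomes, on which the rest of the program may
depend; at the end a pair of `n`-bit strings is output. A projective measurement, a measurement
in the computational basis and a classical coin flip are special cases of `measure`. -/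
inductive Program (n : ℕ) (W : Type*) [Fintype W] : Type _
  | output (p : Bits n × Bits n) : Program n W
  | gate (U : Memory n W ≃ₗᵢ[ℂ] Memory n W) (next : Program n W) : Program n W
  | query (d : Direction) (next : Program n W) : Program n W
  | measure (k : ℕ) (M : Fin k → (Memory n W →L[ℂ] Memory n W))
      (complete : ∑ i, ContinuousLinearMap.adjoint (M i) ∘L M i
        = ContinuousLinearMap.id ℂ (Memory n W))
      (next : Fin k → Program n W) : Program n W

/-- The number of queries, in either direction, that a program makes: the maximum over all
sequences of measurement outcomes. -/
def Program.queries {n : ℕ} {W : Type*} [Fintype W] : Program n W → ℕ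
  | .output _ => 0
  | .gate _ next => next.queries
  | .query _ next => next.queries + 1
  | .measure _ _ _ next => Finset.univ.sup fun i => (next i).queries

open scoped Classical in
/-- The probability that a program with oracles `φ` and `φ⁻¹`, started in the state `ψ`,
outputs `p`. States are not renormalised after a measurement, so that the squared norm of the
state at an output is the probability of the sequence of outcomes leading there. -/
def Program.outputProb {n : ℕ} {W : Type*} [Fintype W] (φ : Equiv.Perm (Bits (n + n)))
    (p : Bits n × Bits n) : Program n W → Memory n W → ℝ
  | .output q, ψ => if q = p then ‖ψ‖ ^ 2 else 0
  | .gate U next, ψ => next.outputProb φ p (U ψ)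
  | .query d next, ψ => next.outputProb φ p (oracle (d.queried φ) ψ)
  | .measure _ M _ next, ψ => ∑ i, (next i).outputProb φ p (M i ψ)

/-- A quantum query algorithm: a unit vector as initial state, and a program. -/
structure QueryAlgorithm (n : ℕ) (W : Type*) [Fintype W] where
  init : Memory n W
  norm_init : ‖init‖ = 1
  program : Program n W

/-- The number of queries to `φ` and `φ⁻¹` together. -/
def QueryAlgorithm.queries {n : ℕ} {W : Type*} [Fintype W] (A : QueryAlgorithm n W) : ℕ :=
  A.program.queries

open scoped Classical in
/-- The probability that the algorithm outputs a zero pair of the fixed permutation `φ`. -/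
def QueryAlgorithm.successProbOn {n : ℕ} {W : Type*} [Fintype W] (A : QueryAlgorithm n W)
    (φ : Equiv.Perm (Bits (n + n))) : ℝ :=
  ∑ p : Bits n × Bits n, if IsZeroPair φ p then A.program.outputProb φ p A.init else 0

/-- The probability of outputting a zero pair of `φ`, over a uniformly random permutation `φ`
of the `2n`-bit strings and the randomness of the measurements. -/
def QueryAlgorithm.successProb {n : ℕ} {W : Type*} [Fintype W] (A : QueryAlgorithm n W) : ℝ :=
  (∑ φ : Equiv.Perm (Bits (n + n)), A.successProbOn φ) /
    (Fintype.card (Equiv.Perm (Bits (n + n))) : ℝ)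

end

end DoubleSidedZeroSearch

namespace DoubleSidedZeroSearch

open Finset

/-! ### Hybrid argument for adaptive programs -/

section Programs

variable {n : ℕ} {W : Type*} [Fintype W]

/-! Plant a zero pair `p` in a uniformly random `π`: by `sum_reprogram` the result is uniform among
permutations having `p` as a zero pair, so the success probability is `4^{-n}` times the mean over
`π` of the sum over `p` of the probability of outputting `p` after planting it.

For fixed `π`, `Program.outputProb_le_add_queryWeight` compares this with the run on `π` itself.
That run does not depend on `p`, so its output probabilities sum to 1, and each query input is
affected by at most `2 * 2 ^ n` of the `4^n` plantings (`sum_disagreement_reprogram_le`). The total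
is at most `2 + 48 T (T + 2) 2^n`.

The hybrid bound uses weighted squared norms rather than a triangle inequality for norms: squared
norms of unnormalised states add up over measurement outcomes, so the induction passes through
adaptive measurements. -/

lemma oracle_apply (f : Bits (n + n) → Bits (n + n)) (ψ : Memory n W) (z : BasisLabel n W) :
    oracle f ψ z = ψ ((oracleEquiv f).symm z) := rfl

/-- A complete family of measurement operators preserves the total squared norm. -/
lemma sum_norm_sq_of_complete {k : ℕ} {M : Fin k → (Memory n W →L[ℂ] Memory n W)}
    (complete : ∑ i, ContinuousLinearMap.adjoint (M i) ∘L M i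
      = ContinuousLinearMap.id ℂ (Memory n W)) (ψ : Memory n W) :
    ∑ i, ‖M i ψ‖ ^ 2 = ‖ψ‖ ^ 2 := by
  have h : ∑ i, inner ℂ (M i ψ) (M i ψ) = inner ℂ ψ ψ := by
    have h₁ := congrArg (fun L : Memory n W →L[ℂ] Memory n W => inner ℂ ψ (L ψ)) complete
    simpa [_root_.sum_apply, inner_sum, ContinuousLinearMap.adjoint_inner_right]
      using h₁
  simp only [inner_self_eq_norm_sq_to_K] at h
  exact_mod_cast h

lemma Program.sum_outputProb (φ : Equiv.Perm (Bits (n + n))) (P : Program n W) :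
    ∀ ψ : Memory n W, ∑ p, P.outputProb φ p ψ = ‖ψ‖ ^ 2 := by
  induction P with
  | output q => intro ψ; simp [outputProb]
  | gate U next ih => intro ψ; simp [outputProb, ih]
  | query d next ih => intro ψ; simp [outputProb, ih]
  | measure k M complete next ih =>
    intro ψ
    simp only [outputProb]
    rw [sum_comm]
    simp only [ih]
    exact sum_norm_sq_of_complete complete ψ

/-- The expected value, summed over all queries that a program makes when run with oracles `φ`
and `φ⁻¹`, of the weight `w` of the measured query input. -/
noncomputable def Program.queryWeight (φ : Equiv.Perm (Bits (n + n)))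
    (w : Direction → Bits (n + n) → ℝ) : Program n W → Memory n W → ℝ
  | .output _, _ => 0
  | .gate U next, ψ => next.queryWeight φ w (U ψ)
  | .query d next, ψ =>
    ∑ z, w d z.1 * ‖ψ z‖ ^ 2 + next.queryWeight φ w (oracle (d.queried φ) ψ)
  | .measure _ M _ next, ψ => ∑ i, (next i).queryWeight φ w (M i ψ)

lemma Program.queryWeight_nonneg (φ : Equiv.Perm (Bits (n + n)))
    {w : Direction → Bits (n + n) → ℝ} (hw : ∀ d x, 0 ≤ w d x) (P : Program n W) :
    ∀ ψ : Memory n W, 0 ≤ P.queryWeight φ w ψ := by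
  induction P with
  | output q => intro ψ; exact le_rfl
  | gate U next ih => intro ψ; exact ih _
  | query d next ih =>
    intro ψ
    exact add_nonneg (sum_nonneg fun z _ => mul_nonneg (hw _ _) (sq_nonneg _)) (ih _)
  | measure k M complete next ih => intro ψ; exact sum_nonneg fun i _ => ih i _

/-- The run is the same for all `i`, so the weights can be summed inside each query. Each level of
queries sees total squared norm at most `‖ψ‖ ^ 2`. -/
lemma Program.sum_queryWeight_le {ι : Type*} [Fintype ι] (φ : Equiv.Perm (Bits (n + n)))
    {w : ι → Direction → Bits (n + n) → ℝ} {C : ℝ} (hC : 0 ≤ C)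
    (hw : ∀ d x, ∑ i, w i d x ≤ C) (P : Program n W) :
    ∀ ψ : Memory n W, ∑ i, P.queryWeight φ (w i) ψ ≤ C * P.queries * ‖ψ‖ ^ 2 := by
  induction P with
  | output q => intro ψ; simp [queryWeight, queries]
  | gate U next ih => intro ψ; simpa [queryWeight, queries] using ih (U ψ)
  | query d next ih =>
    intro ψ
    have h₁ : ∑ i, ∑ z, w i d z.1 * ‖ψ z‖ ^ 2 ≤ C * ‖ψ‖ ^ 2 := by
      rw [sum_comm, EuclideanSpace.norm_sq_eq, mul_sum]
      refine sum_le_sum fun z _ => ?_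
      rw [← sum_mul]
      exact mul_le_mul_of_nonneg_right (hw d z.1) (sq_nonneg _)
    have h₂ := ih (oracle (d.queried φ) ψ)
    rw [LinearIsometryEquiv.norm_map] at h₂
    simp only [queryWeight, queries, sum_add_distrib, Nat.cast_add, Nat.cast_one]
    linarith
  | measure k M complete next ih =>
    intro ψ
    simp only [queryWeight, queries]
    rw [sum_comm, ← sum_norm_sq_of_complete complete ψ, mul_sum]
    refine sum_le_sum fun i _ => (ih i _).trans ?_
    gcongr
    exact le_sup (f := fun i => (next i).queries) (mem_univ i)

open scoped Classical in
/-- The indicator function of the query inputs on which two permutations, or their inverses,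
disagree. -/
noncomputable def disagreement (φ φ' : Equiv.Perm (Bits (n + n))) (d : Direction)
    (x : Bits (n + n)) : ℝ :=
  if d.queried φ x = d.queried φ' x then 0 else 1

lemma disagreement_nonneg (φ φ' : Equiv.Perm (Bits (n + n))) (d : Direction)
    (x : Bits (n + n)) : 0 ≤ disagreement φ φ' d x := by
  unfold disagreement; split_ifs <;> norm_num

/-- Two oracle unitaries differ on a state only through its part on which the queried functions
disagree. -/
lemma norm_sq_oracle_sub_oracle_le (φ φ' : Equiv.Perm (Bits (n + n))) (d : Direction)
    (ψ : Memory n W) :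
    ‖oracle (d.queried φ') ψ - oracle (d.queried φ) ψ‖ ^ 2
      ≤ 4 * ∑ z, disagreement φ φ' d z.1 * ‖ψ z‖ ^ 2 := by
  -- The weight depends only on the query input, which the oracle leaves unchanged.
  have key : ∀ f : Bits (n + n) → Bits (n + n),
      ∑ z, disagreement φ φ' d z.1 * ‖oracle f ψ z‖ ^ 2
        = ∑ z, disagreement φ φ' d z.1 * ‖ψ z‖ ^ 2 := fun f =>
    Fintype.sum_equiv (oracleEquiv f).symm _ _ fun z => rfl
  have h : ‖oracle (d.queried φ') ψ - oracle (d.queried φ) ψ‖ ^ 2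
      ≤ 2 * ∑ z, disagreement φ φ' d z.1 * ‖oracle (d.queried φ') ψ z‖ ^ 2
        + 2 * ∑ z, disagreement φ φ' d z.1 * ‖oracle (d.queried φ) ψ z‖ ^ 2 := by
    rw [EuclideanSpace.norm_sq_eq, mul_sum, mul_sum, ← sum_add_distrib]
    refine sum_le_sum fun z _ => ?_
    rw [PiLp.sub_apply]
    by_cases hz : d.queried φ z.1 = d.queried φ' z.1
    · have : oracle (d.queried φ') ψ z = oracle (d.queried φ) ψ z := by
        simp [oracle_apply, oracleEquiv, hz]
      simp [this, disagreement, hz]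
    · have := norm_sub_le (oracle (d.queried φ') ψ z) (oracle (d.queried φ) ψ z)
      simp only [disagreement, hz, if_false, one_mul]
      nlinarith [sq_nonneg (‖oracle (d.queried φ') ψ z‖ - ‖oracle (d.queried φ) ψ z‖),
        norm_nonneg (oracle (d.queried φ') ψ z - oracle (d.queried φ) ψ z)]
  rw [key, key] at h
  linarith

/-- A weighted form of the inequality `(a + b)² ≤ 2 a² + 2 b²`. -/
lemma norm_add_sq_le_weighted {E : Type*} [SeminormedAddCommGroup E] (u v : E) {m : ℝ}
    (hm : 0 < m) : ‖u + v‖ ^ 2 ≤ (1 + 1 / m) * ‖u‖ ^ 2 + (m + 1) * ‖v‖ ^ 2 := by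
  have h₁ : ‖u + v‖ ^ 2 ≤ (‖u‖ + ‖v‖) ^ 2 := by gcongr; exact norm_add_le u v
  have h₂ : (1 + 1 / m) * ‖u‖ ^ 2 + (m + 1) * ‖v‖ ^ 2 - (‖u‖ + ‖v‖) ^ 2
      = (‖u‖ - m * ‖v‖) ^ 2 / m := by
    field_simp
    ring
  have h₃ : 0 ≤ (‖u‖ - m * ‖v‖) ^ 2 / m := by positivity
  linarith

/-- The hybrid argument: replacing `φ` by `φ'` changes output probabilities only as far as the
run with `φ` queries points on which the two permutations or their inverses disagree. -/
lemma Program.outputProb_le_add_queryWeight (φ φ' : Equiv.Perm (Bits (n + n)))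
    (p : Bits n × Bits n) {m : ℝ} (hm : 0 < m) (P : Program n W) :
    ∀ (k : ℕ) (ψ ψ' : Memory n W), P.queries ≤ k →
      P.outputProb φ' p ψ' ≤ 2 * P.outputProb φ p ψ + 2 * (1 + 1 / m) ^ k *
        (‖ψ' - ψ‖ ^ 2 + 4 * (m + 1) * P.queryWeight φ (disagreement φ φ') ψ) := by
  have hc : 1 ≤ 1 + 1 / m := by have : 0 < 1 / m := by positivity
                                linarith
  induction P with
  | output q =>
    intro k ψ ψ' _
    have hk : 1 ≤ (1 + 1 / m) ^ k := one_le_pow₀ hc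
    simp only [outputProb, queryWeight, mul_zero, add_zero]
    split_ifs
    -- Weight 1 gives the two leading factors 2 of the bound.
    · have h := norm_add_sq_le_weighted ψ (ψ' - ψ) one_pos
      rw [add_sub_cancel] at h
      nlinarith [sq_nonneg ‖ψ' - ψ‖]
    · positivity
  | gate U next ih =>
    intro k ψ ψ' hk
    have h := ih k (U ψ) (U ψ') hk
    rwa [← map_sub, LinearIsometryEquiv.norm_map] at h
  | query d next ih =>
    intro k ψ ψ' hk
    obtain ⟨k, rfl⟩ : ∃ j, k = j + 1 := ⟨k - 1, by simp only [queries] at hk; omega⟩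
    have h := ih k (oracle (d.queried φ) ψ) (oracle (d.queried φ') ψ')
      (by simpa [queries] using hk)
    have hδ : ‖oracle (d.queried φ') ψ' - oracle (d.queried φ) ψ‖ ^ 2
        ≤ (1 + 1 / m) * ‖ψ' - ψ‖ ^ 2
          + (m + 1) * (4 * ∑ z, disagreement φ φ' d z.1 * ‖ψ z‖ ^ 2) := by
      -- Split `O'ψ' - Oψ = O'(ψ' - ψ) + (O' - O)ψ`: the old error is carried along isometrically,
      -- and the new error involves only the run with `φ`.
      have h₁ := norm_add_sq_le_weighted (oracle (d.queried φ') (ψ' - ψ))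
        (oracle (d.queried φ') ψ - oracle (d.queried φ) ψ) hm
      rw [LinearIsometryEquiv.norm_map, map_sub, sub_add_sub_cancel] at h₁
      have := norm_sq_oracle_sub_oracle_le φ φ' d ψ
      exact h₁.trans (by gcongr)
    simp only [outputProb, queryWeight]
    set Q := next.queryWeight φ (disagreement φ φ') (oracle (d.queried φ) ψ)
    set q := ∑ z, disagreement φ φ' d z.1 * ‖ψ z‖ ^ 2
    have hQ : 0 ≤ Q := next.queryWeight_nonneg φ (disagreement_nonneg φ φ') _
    have hq : 0 ≤ q :=
      sum_nonneg fun z _ => mul_nonneg (disagreement_nonneg _ _ _ _) (sq_nonneg _)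
    have hle : ‖oracle (d.queried φ') ψ' - oracle (d.queried φ) ψ‖ ^ 2 + 4 * (m + 1) * Q
        ≤ (1 + 1 / m) * (‖ψ' - ψ‖ ^ 2 + 4 * (m + 1) * (q + Q)) := by
      have : 1 * (4 * (m + 1) * (q + Q)) ≤ (1 + 1 / m) * (4 * (m + 1) * (q + Q)) := by
        gcongr
      linarith
    refine h.trans ?_
    rw [pow_succ (1 + 1 / m), ← mul_assoc, mul_assoc (2 * (1 + 1 / m) ^ k)]
    gcongr
  | measure k M complete next ih =>
    intro k ψ ψ' hk
    simp only [outputProb, queryWeight]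
    -- Every term is now a sum over outcomes; the common budget `k` gives all branches the same
    -- exponent.
    rw [← sum_norm_sq_of_complete complete (ψ' - ψ), mul_sum, mul_sum, ← sum_add_distrib,
      mul_sum, ← sum_add_distrib]
    refine sum_le_sum fun i _ => ?_
    rw [map_sub]
    exact ih i k _ _ ((le_sup (f := fun i => (next i).queries) (mem_univ i)).trans hk)

end Programs

/-! ### Planting a zero pair -/

section Reprogramming

variable {n : ℕ}

lemma padZero_injective : Function.Injective (padZero : Bits n → Bits (n + n)) := by
  intro x y h
  funext i
  simpa [padZero] using congrFun h (Fin.castAdd n i)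

/-- The permutation `π` changed so as to map `a` to `b`. -/
def reprogram {α : Type*} [DecidableEq α] (π : Equiv.Perm α) (a b : α) : Equiv.Perm α :=
  Equiv.swap (π a) b * π

/-- If `π` is a uniformly random permutation, then `reprogram π a b` is a uniformly random
permutation among those that map `a` to `b`. -/
lemma sum_reprogram {α : Type*} [Fintype α] [DecidableEq α] (a b : α)
    (g : Equiv.Perm α → ℝ) :
    ∑ π, g (reprogram π a b) = Fintype.card α * ∑ φ, if φ a = b then g φ else 0 := by
  have h₁ : ∀ π : Equiv.Perm α, g (reprogram π a b)
      = ∑ c, if π a = c then g (Equiv.swap c b * π) else 0 := fun π => by simp [reprogram]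
  -- Left multiplication by `swap c b` matches the `π` with `π a = c` to the `φ` with `φ a = b`. The
  -- sum does not depend on `c`, whence the factor `card α`.
  have h₂ : ∀ c, ∑ π : Equiv.Perm α, (if π a = c then g (Equiv.swap c b * π) else 0)
      = ∑ φ : Equiv.Perm α, if φ a = b then g φ else 0 := fun c =>
    Fintype.sum_equiv (Equiv.mulLeft (Equiv.swap c b)) _ _ fun π => by
      simp [Equiv.swap_apply_eq_iff]
  simp_rw [h₁]
  rw [sum_comm, sum_congr rfl fun c _ => h₂ c]
  simp

/-- Only the preimages `a` and `π⁻¹ b` and the images `π a` and `b` are affected. So a forward query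
`x` notices the change only if `a = x` or `b = π x`, an inverse query only if `a = π⁻¹ x` or `b =
x`. -/
lemma exists_disagreement_reprogram_le (π : Equiv.Perm (Bits (n + n))) (d : Direction)
    (x : Bits (n + n)) :
    ∃ u v : Bits (n + n), ∀ a b : Bits (n + n),
      disagreement π (reprogram π a b) d x
        ≤ (if a = u then 1 else 0) + (if b = v then 1 else 0) := by
  cases d with
  | forward =>
    refine ⟨x, π x, fun a b => ?_⟩
    by_cases ha : a = x
    · simp only [disagreement, ha]; split_ifs <;> norm_num
    by_cases hb : b = π x
    · simp only [disagreement, hb]; split_ifs <;> norm_num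
    have : Equiv.swap (π a) b (π x) = π x :=
      Equiv.swap_apply_of_ne_of_ne (fun h => ha (π.injective h).symm) (Ne.symm hb)
    simp [disagreement, Direction.queried, reprogram, ha, hb, this]
  | inverse =>
    refine ⟨π.symm x, x, fun a b => ?_⟩
    by_cases ha : a = π.symm x
    · simp only [disagreement, ha]; split_ifs <;> norm_num
    by_cases hb : b = x
    · simp only [disagreement, hb]; split_ifs <;> norm_num
    have : (reprogram π a b).symm x = π.symm x := by
      rw [Equiv.symm_apply_eq]
      simp only [reprogram, Equiv.Perm.mul_apply, Equiv.apply_symm_apply]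
      refine (Equiv.swap_apply_of_ne_of_ne (fun h => ha ?_) (Ne.symm hb)).symm
      rw [h, Equiv.symm_apply_apply]
    simp [disagreement, Direction.queried, this, ha, hb]

lemma sum_padZero_eq_le_one (u : Bits (n + n)) :
    ∑ x : Bits n, (if padZero x = u then (1 : ℝ) else 0) ≤ 1 := by
  rw [sum_boole]
  have h : #{x : Bits n | padZero x = u} ≤ 1 := card_le_one.2 fun x hx y hy =>
    padZero_injective ((mem_filter.1 hx).2.trans (mem_filter.1 hy).2.symm)
  exact_mod_cast h

/-- A query input is affected by reprogramming at few of the pairs of padded strings. -/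
lemma sum_disagreement_reprogram_le (π : Equiv.Perm (Bits (n + n))) (d : Direction)
    (x : Bits (n + n)) :
    ∑ p : Bits n × Bits n, disagreement π (reprogram π (padZero p.1) (padZero p.2)) d x
      ≤ 2 * 2 ^ n := by
  obtain ⟨u, v, h⟩ := exists_disagreement_reprogram_le π d x
  refine (sum_le_sum fun p _ => h (padZero p.1) (padZero p.2)).trans ?_
  have hu := sum_padZero_eq_le_one u
  have hv := sum_padZero_eq_le_one v
  have hcard : (Fintype.card (Bits n) : ℝ) = 2 ^ n := by simp
  have h₁ : ∑ p : Bits n × Bits n, (if padZero p.1 = u then (1 : ℝ) else 0)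
      = ∑ x : Bits n, ∑ _y : Bits n, if padZero x = u then 1 else 0 := Fintype.sum_prod_type _
  have h₂ : ∑ p : Bits n × Bits n, (if padZero p.2 = v then (1 : ℝ) else 0)
      = ∑ _x : Bits n, ∑ y : Bits n, if padZero y = v then 1 else 0 := Fintype.sum_prod_type _
  rw [sum_add_distrib, h₁, h₂]
  simp only [sum_const, card_univ, nsmul_eq_mul, ← mul_sum, hcard]
  have : (0 : ℝ) < 2 ^ n := by positivity
  nlinarith

end Reprogramming

/-! ### Assembling the constants -/

lemma one_add_one_div_pow_le_three (T : ℕ) : (1 + 1 / ((T : ℝ) + 1)) ^ T ≤ 3 := by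
  have h₁ : 1 + 1 / ((T : ℝ) + 1) ≤ Real.exp (1 / ((T : ℝ) + 1)) := by
    rw [add_comm]; exact Real.add_one_le_exp _
  have hT : T * (1 / ((T : ℝ) + 1)) ≤ 1 := by
    rw [mul_one_div, div_le_one (by positivity)]; linarith
  calc (1 + 1 / ((T : ℝ) + 1)) ^ T ≤ Real.exp (1 / ((T : ℝ) + 1)) ^ T := by gcongr
    _ = Real.exp (T * (1 / ((T : ℝ) + 1))) := by rw [← Real.exp_nat_mul]
    _ ≤ Real.exp 1 := Real.exp_le_exp.2 hT
    _ ≤ 3 := Real.exp_one_lt_three.le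

/-- For every permutation `π`, the probabilities of finding the planted zero pair, summed over all
ways of planting one, are bounded. -/
lemma QueryAlgorithm.sum_outputProb_reprogram_le {n T : ℕ} {W : Type*} [Fintype W]
    (A : QueryAlgorithm n W) (hT : A.queries ≤ T) (π : Equiv.Perm (Bits (n + n))) :
    ∑ p : Bits n × Bits n,
        A.program.outputProb (reprogram π (padZero p.1) (padZero p.2)) p A.init
      ≤ 2 + 48 * (T * (T + 2)) * 2 ^ n := by
  -- The weight `m = T + 1` keeps the growth over `T` queries below 3, and is positive even for `T =
  -- 0`.
  have hm : (0 : ℝ) < (T : ℝ) + 1 := by positivity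
  refine (sum_le_sum fun p _ => A.program.outputProb_le_add_queryWeight π
    (reprogram π (padZero p.1) (padZero p.2)) p hm T A.init A.init hT).trans ?_
  have hQ := A.program.sum_queryWeight_le π (by positivity)
    (sum_disagreement_reprogram_le π) A.init
  simp only [sub_self, norm_zero, ne_eq, OfNat.ofNat_ne_zero, not_false_eq_true, zero_pow,
    zero_add, sum_add_distrib, ← mul_sum, Program.sum_outputProb, A.norm_init, one_pow,
    mul_one] at hQ ⊢
  have hT' : (A.program.queries : ℝ) ≤ T := by exact_mod_cast hT
  have hQT := hQ.trans (mul_le_mul_of_nonneg_left hT' (by positivity))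
  have hc := one_add_one_div_pow_le_three T
  calc _ ≤ 2 + 2 * 3 * (4 * ((T : ℝ) + 1 + 1) * (2 * 2 ^ n * T)) := by
        gcongr
        exact mul_nonneg (by positivity)
          (sum_nonneg fun p _ => A.program.queryWeight_nonneg π (disagreement_nonneg _ _) _)
    _ = _ := by ring

end DoubleSidedZeroSearch

open DoubleSidedZeroSearch in
theorem mainTheorem1 (n T : ℕ) {W : Type*} [Fintype W]
    (A : DoubleSidedZeroSearch.QueryAlgorithm n W) (hT : A.queries ≤ T) :
    A.successProb ≤ 50 * ((T : ℝ) + 1) ^ 2 / 2 ^ n := by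
  classical
  have hN : (1 : ℝ) ≤ 2 ^ n := one_le_pow₀ (by norm_num)
  have hsum : (2 ^ n * 2 ^ n) * ∑ φ : Equiv.Perm (Bits (n + n)), A.successProbOn φ
      = ∑ π : Equiv.Perm (Bits (n + n)), ∑ p : Bits n × Bits n,
        A.program.outputProb (reprogram π (padZero p.1) (padZero p.2)) p A.init := by
    have hcard : (Fintype.card (Bits (n + n)) : ℝ) = 2 ^ n * 2 ^ n := by simp [pow_add]
    simp only [QueryAlgorithm.successProbOn, IsZeroPair]
    rw [Finset.sum_comm, Finset.sum_comm (s := Finset.univ (α := Equiv.Perm (Bits (n + n)))),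
      Finset.mul_sum]
    refine Finset.sum_congr rfl fun p _ => ?_
    rw [← hcard]
    convert (sum_reprogram (padZero p.1) (padZero p.2)
      fun φ => A.program.outputProb φ p A.init).symm using 3
    split_ifs with h <;> simp [h]
  have hle := Finset.sum_le_sum fun (π : Equiv.Perm (Bits (n + n))) (_ : π ∈ Finset.univ) =>
    A.sum_outputProb_reprogram_le hT π
  rw [← hsum, Finset.sum_const, Finset.card_univ, nsmul_eq_mul] at hle
  have hcard : (0 : ℝ) < Fintype.card (Equiv.Perm (Bits (n + n))) := by
    exact_mod_cast Fintype.card_pos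
  rw [QueryAlgorithm.successProb, div_le_iff₀ hcard, div_mul_eq_mul_div,
    le_div_iff₀ (by positivity)]
  refine le_of_mul_le_mul_left ?_ (by positivity : (0 : ℝ) < 2 ^ n)
  calc _ = _ := by ring
    _ ≤ _ := hle
    _ ≤ Fintype.card (Equiv.Perm (Bits (n + n))) * (2 ^ n * (50 * ((T : ℝ) + 1) ^ 2)) := by
        gcongr
        -- With `2 ≤ 2 * 2 ^ n` it remains that `2 + 48 T (T + 2) ≤ 50 (T + 1)^2`.
        nlinarith [sq_nonneg (T : ℝ), (T.cast_nonneg : (0 : ℝ) ≤ T)]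
    _ = _ := by ring
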